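/- Let $n\ge 1$ and let $A=(A(i,j))_{1\le i,j\le n}$ be a real matrix with nonnegative entries. For $1\le j\le n$ let $C_j=|\{i : A(i,j)\neq 0\}|$ be the number of nonzero entries in the $j$-th column of $A$. Put $$\mathrm{Mul}_A(t_1,\dots,t_n)=\prod_{i=1}^n\sum_{j=1}^n A(i,j)\,t_j ,\qquad \mathrm{Cap}(p)=\inf\Big\{p(x_1,\dots,x_n) : x_i>0 \text{ for all } i,\ \prod_{i=1}^n x_i=1\Big\},$$ and $g(0)=1$, $g(k)=\left(\frac{k-1}{k}\right)^{k-1}$ for integers $k\ge 1$, with the convention $0^0=1$ (so $g(1)=1$). Then $$\mathrm{per}(A)\ \ge\ \prod_{j=1}^n g\big(\min(C_j,\,n+1-j)\big)\cdot \mathrm{Cap}(\mathrm{Mul}_A).$$ If moreover $1\le k\le n$ is an integer such that $C_j\le k$ for all $1\le j\le n$, then (again with $0^0=1$) $$\mathrm{per}(A)\ \ge\ \left(\frac{k-1}{k}\right)^{(k-1)(n-k)}\frac{k!}{k^k}\,\mathrm{Cap}(\mathrm{Mul}_A).$$ Finally, if $A$ is doubly stochastic, then $\mathrm{Cap}(\mathrm{Mul}_A)=1$.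 -/

import Mathlib

namespace PermBound

/-- `g(k) = ((k-1)/k)^(k-1)` for `k ≥ 1`, and `g(0) = 1` (see `g_zero`). -/
noncomputable def g (k : ℕ) : ℝ := (((k : ℝ) - 1) / k) ^ (k - 1)

theorem g_zero : g 0 = 1 := by simp [g]

/-- The polynomial `Mul_A(t_1, …, t_n) = ∏_i ∑_j A(i,j) t_j`. -/
noncomputable def mulPoly {n : ℕ} (A : Matrix (Fin n) (Fin n) ℝ) : MvPolynomial (Fin n) ℝ :=
  ∏ i, ∑ j, MvPolynomial.C (A i j) * MvPolynomial.X j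

/-- The capacity: the infimum of `p(x_1, …, x_n)` over all `x` with `x_i > 0` for all `i` and
`∏ x_i = 1`. The set of values is nonempty (take `x = (1, …, 1)`), and it is bounded below by `0`
if the coefficients of `p` are nonnegative, so that this is a genuine infimum for such `p`. -/
noncomputable def capacity {n : ℕ} (p : MvPolynomial (Fin n) ℝ) : ℝ :=
  sInf ((fun x : Fin n → ℝ => MvPolynomial.eval x p) ''
    {x : Fin n → ℝ | (∀ i, 0 < x i) ∧ ∏ i, x i = 1})

/-- `C_j`, the number of nonzero entries in the `j`-th column of `A`. -/
noncomputable def colCount {n : ℕ} (A : Matrix (Fin n) (Fin n) ℝ) (j : Fin n) : ℕ :=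
  Set.ncard {i : Fin n | A i j ≠ 0}

end PermBound

/-! This is Gurvits' argument. `mulPoly A` is homogeneous of degree `n` with nonnegative
coefficients, is zero or has no zeros with all coordinates in the right half-plane, and its
coefficient at `x₁ ⋯ xₙ` is the permanent. That coefficient is extracted one variable at a time.
Passing to the coefficient of `x₀` keeps these properties (`Stable.coeff_one`) and costs the
capacity at most a factor `g k`, where `k` bounds the degree in `x₀` (`g_mul_capacity_le`); after
`j` extractions the total degree is `n - j`, hence the minimum in the bound. The cost is a
univariate fact (`g_mul_le_coeff_one`): for positive `x` with product 1, `t ↦ p(t, x)` is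
real-rooted with nonnegative coefficients and at least `Cap(p) t`, and AM-GM over its roots bounds
its linear coefficient below. -/

namespace PermBound

/-! ### Real-rooted univariate polynomials. -/

section Univariate

open Polynomial

/-- Each factor satisfies `a ≤ c * exp (a / c - 1)`. When `c` is the mean the exponential is 1,
which is AM-GM. -/
theorem multiset_prod_le_pow_mul_exp (s : Multiset ℝ) (hs : ∀ x ∈ s, 0 ≤ x) {c : ℝ} (hc : 0 < c) :
    s.prod ≤ c ^ s.card * Real.exp (s.sum / c - s.card) := by
  induction s using Multiset.induction with
  | empty => simp
  | cons a s ih =>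
    have ha : 0 ≤ a := hs a (Multiset.mem_cons_self a s)
    have h1 : a ≤ c * Real.exp (a / c - 1) := by
      have := Real.add_one_le_exp (a / c - 1)
      calc a = c * (a / c - 1 + 1) := by field_simp; ring
        _ ≤ _ := by gcongr
    have h2 := ih fun x hx => hs x (Multiset.mem_cons_of_mem hx)
    have h3 : 0 ≤ s.prod := Multiset.prod_nonneg fun x hx => hs x (Multiset.mem_cons_of_mem hx)
    rw [Multiset.prod_cons, Multiset.card_cons, Multiset.sum_cons]
    calc a * s.prod ≤ (c * Real.exp (a / c - 1)) *
          (c ^ s.card * Real.exp (s.sum / c - s.card)) := by gcongr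
      _ = c ^ (s.card + 1) * (Real.exp (a / c - 1) * Real.exp (s.sum / c - s.card)) := by ring
      _ = _ := by
        rw [← Real.exp_add]
        congr 2
        push_cast
        ring

/-- The arithmetic-geometric mean inequality for `1 + x` with `x ∈ s`, padded to `k` factors. -/
theorem multiset_prod_one_add_le (s : Multiset ℝ) (hs : ∀ x ∈ s, 0 ≤ x) {k : ℕ} (hk : 0 < k)
    (hsk : s.card ≤ k) : (s.map fun x => 1 + x).prod ≤ (1 + s.sum / k) ^ k := by
  have hk' : (0 : ℝ) < k := by exact_mod_cast hk
  have hsum : 0 ≤ s.sum := Multiset.sum_nonneg hs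
  have hc : 0 < 1 + s.sum / k := by positivity
  have h := multiset_prod_le_pow_mul_exp
    ((s.map fun x => 1 + x) + Multiset.replicate (k - s.card) 1) (by
      intro x hx
      rcases Multiset.mem_add.1 hx with hx | hx
      · obtain ⟨y, hy, rfl⟩ := Multiset.mem_map.1 hx
        linarith [hs y hy]
      · rw [Multiset.eq_of_mem_replicate hx]
        exact zero_le_one) hc
  have hcard : ((s.map fun x => 1 + x) + Multiset.replicate (k - s.card) (1 : ℝ)).card = k := by
    simp [hsk]
  have hs' : ((s.map fun x => 1 + x) + Multiset.replicate (k - s.card) (1 : ℝ)).sum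
      = k * (1 + s.sum / k) := by
    rw [Multiset.sum_add, Multiset.sum_map_add]
    simp only [Multiset.map_const', Multiset.sum_replicate, Multiset.map_id', nsmul_eq_mul, mul_one]
    rw [Nat.cast_sub hsk]
    field_simp
    ring
  rw [hcard, hs', mul_div_assoc, div_self hc.ne'] at h
  simpa using h

section Splits

variable {K : Type*} [Field K] {f : K[X]}

theorem eval_eq_coeff_zero_mul_prod (hf : f.Splits) (h0 : f.coeff 0 ≠ 0) (t : K) :
    f.eval t = f.coeff 0 * (f.roots.map fun r => 1 - t / r).prod := by
  have hr : ∀ r ∈ f.roots, r ≠ 0 := by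
    rintro r hr rfl
    exact h0 (by simpa [coeff_zero_eq_eval_zero] using (mem_roots'.1 hr).2)
  rw [coeff_zero_eq_eval_zero, hf.eval_eq_prod_roots, hf.eval_eq_prod_roots, mul_assoc,
    ← Multiset.prod_map_mul]
  congr 2
  refine Multiset.map_congr rfl fun r h => ?_
  have := hr r h
  field_simp
  ring

theorem coeff_one_eq_coeff_zero_mul_sum (hf : f.Splits) (h0 : f.coeff 0 ≠ 0) :
    f.coeff 1 = f.coeff 0 * (f.roots.map fun r => -r⁻¹).sum := by
  have := hf.eval_derivative_eq_eval_mul_sum (x := 0) (by rwa [← coeff_zero_eq_eval_zero])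
  rw [← coeff_zero_eq_eval_zero, ← coeff_zero_eq_eval_zero, coeff_derivative] at this
  have h : (fun z : K => 1 / (0 - z)) = fun r => -r⁻¹ := by
    funext z
    rw [zero_sub, one_div, inv_neg]
  rwa [h, Nat.cast_zero, zero_add, zero_add, mul_one] at this

end Splits

theorem splits_of_forall_im_ne_zero {f : ℝ[X]}
    (h : ∀ z : ℂ, z.im ≠ 0 → (f.map (algebraMap ℝ ℂ)).eval z ≠ 0) : f.Splits := by
  refine Splits.of_splits_map_of_injective (i := algebraMap ℝ ℂ) (algebraMap ℝ ℂ).injective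
    (IsAlgClosed.splits _) fun a ha => ?_
  have : a.im = 0 := by
    by_contra h'
    exact h a h' (mem_roots'.1 ha).2
  exact ⟨a.re, Complex.ext (by simp) (by simp [this])⟩

theorem g_nonneg (k : ℕ) : 0 ≤ g k := by
  rcases Nat.eq_zero_or_pos k with rfl | hk
  · rw [g_zero]; exact zero_le_one
  · have : (1 : ℝ) ≤ k := by exact_mod_cast hk
    exact pow_nonneg (div_nonneg (by linarith) (by linarith)) _

theorem g_le_one (k : ℕ) : g k ≤ 1 := by
  rcases Nat.eq_zero_or_pos k with rfl | hk
  · rw [g_zero]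
  · have : (1 : ℝ) ≤ k := by exact_mod_cast hk
    refine pow_le_one₀ (div_nonneg (by linarith) (by linarith)) ?_
    rw [div_le_one (by linarith)]
    linarith

theorem coeff_zero_add_le_eval {f : ℝ[X]} (hf : ∀ i, 0 ≤ f.coeff i) {t : ℝ} (ht : 0 ≤ t) :
    f.coeff 0 + f.coeff 1 * t ≤ f.eval t := by
  rw [eval_eq_sum_range' (n := f.natDegree + 2) (by omega), Finset.sum_range_succ',
    Finset.sum_range_succ']
  have : 0 ≤ ∑ i ∈ Finset.range f.natDegree, f.coeff (i + 1 + 1) * t ^ (i + 1 + 1) :=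
    Finset.sum_nonneg fun i _ => mul_nonneg (hf _) (pow_nonneg ht _)
  simp only [zero_add, pow_one, pow_zero, mul_one]
  linarith

theorem coeff_zero_le_eval {f : ℝ[X]} (hf : ∀ i, 0 ≤ f.coeff i) {t : ℝ} (ht : 0 ≤ t) :
    f.coeff 0 ≤ f.eval t :=
  le_trans (le_add_of_nonneg_right (mul_nonneg (hf 1) ht)) (coeff_zero_add_le_eval hf ht)

/-- An affine bound for all positive arguments bounds the slope. -/
theorem le_of_forall_mul_le_add_mul {a b c : ℝ} (h : ∀ t : ℝ, 0 < t → c * t ≤ a + b * t) :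
    c ≤ b := by
  by_contra hbc
  push Not at hbc
  have h1 := h ((|a| + 1) / (c - b)) (div_pos (by positivity) (by linarith))
  have h2 : (c - b) * ((|a| + 1) / (c - b)) = |a| + 1 := by
    field_simp [(sub_pos.2 hbc).ne']
  linarith [le_abs_self a]

/-- Nonnegative coefficients make all roots negative, so `f(t) / f(0)` is a product of factors `1 +
t / |r|`, and the `1 / |r|` sum to `f'(0) / f(0)`. -/
theorem eval_le_of_splits {f : ℝ[X]} (hf : ∀ i, 0 ≤ f.coeff i) (hs : f.Splits) {k : ℕ}
    (hk : 0 < k) (hd : f.natDegree ≤ k) (h0 : 0 < f.coeff 0) {t : ℝ} (ht : 0 ≤ t) :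
    f.eval t ≤ f.coeff 0 * (1 + t * (f.coeff 1 / f.coeff 0) / k) ^ k := by
  have hroot : ∀ r ∈ f.roots, r < 0 := by
    intro r hr
    by_contra hr0
    have h1 := coeff_zero_le_eval hf (not_lt.1 hr0)
    have h2 : f.eval r = 0 := (mem_roots'.1 hr).2
    linarith
  rw [eval_eq_coeff_zero_mul_prod hs h0.ne']
  refine mul_le_mul_of_nonneg_left ?_ h0.le
  have h := multiset_prod_one_add_le (f.roots.map fun r => t * -r⁻¹) (by
    intro x hx
    obtain ⟨r, hr, rfl⟩ := Multiset.mem_map.1 hx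
    have := inv_lt_zero.2 (hroot r hr)
    exact mul_nonneg ht (by linarith)) hk
    (by rw [Multiset.card_map]; exact (card_roots' f).trans hd)
  rw [Multiset.map_map, Multiset.sum_map_mul_left] at h
  rw [coeff_one_eq_coeff_zero_mul_sum hs h0.ne', mul_div_cancel_left₀ _ h0.ne']
  refine le_trans (le_of_eq ?_) h
  congr 1
  refine Multiset.map_congr rfl fun r _ => ?_
  simp only [Function.comp_apply]
  ring

/-- The univariate capacity inequality. -/
theorem g_mul_le_coeff_one {f : ℝ[X]} (hf : ∀ i, 0 ≤ f.coeff i) (hs : f.Splits) {k : ℕ}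
    (hd : f.natDegree ≤ k) {c : ℝ} (hc : ∀ t, 0 < t → c * t ≤ f.eval t) :
    g k * c ≤ f.coeff 1 := by
  rcases le_or_gt c 0 with hc0 | hc0
  · exact (mul_nonpos_of_nonneg_of_nonpos (g_nonneg k) hc0).trans (hf 1)
  have hgc : g k * c ≤ c := mul_le_of_le_one_left hc0.le (g_le_one k)
  rcases (hf 0).eq_or_lt with h0 | h0
  -- With `f(0) = 0`, divide by `t` and let `t → 0+`.
  · refine hgc.trans ?_
    have hX : f = X * f.divX := by
      conv_lhs => rw [← f.X_mul_divX_add, ← h0]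
      simp
    have h1 : ∀ t : ℝ, 0 < t → c ≤ f.divX.eval t := by
      intro t ht
      have := hc t ht
      rw [hX, eval_mul, eval_X, mul_comm] at this
      exact le_of_mul_le_mul_left this ht
    have h2 : f.coeff 1 = f.divX.eval 0 := by
      rw [← coeff_zero_eq_eval_zero, coeff_divX]
    rw [h2]
    have hcont : Filter.Tendsto (fun t => f.divX.eval t) (nhdsWithin 0 (Set.Ioi 0))
        (nhds (f.divX.eval 0)) := f.divX.continuous.continuousWithinAt
    refine ge_of_tendsto hcont ?_
    filter_upwards [self_mem_nhdsWithin] with t ht using h1 t ht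
  rcases Nat.lt_or_ge k 2 with hk | hk
  · refine hgc.trans (le_of_forall_mul_le_add_mul (a := f.coeff 0) fun t ht => ?_)
    refine (hc t ht).trans (le_of_eq ?_)
    rw [eval_eq_sum_range' (n := 2) (by omega)]
    simp [Finset.sum_range_succ]
  have hk0 : 0 < k := by omega
  have hkr : (2 : ℝ) ≤ k := by exact_mod_cast hk
  have hE : ∀ t, 0 < t → c * t ≤ f.coeff 0 * (1 + t * (f.coeff 1 / f.coeff 0) / k) ^ k :=
    fun t ht => (hc t ht).trans (eval_le_of_splits hf hs hk0 hd h0 ht.le)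
  rcases (hf 1).eq_or_lt with h1 | h1
  · exfalso
    have := le_of_forall_mul_le_add_mul (a := f.coeff 0) (b := 0) (c := c) fun t ht => by
      simpa [← h1] using hE t ht
    linarith
  have hkm : (0 : ℝ) < k - 1 := by linarith
  -- This `t` minimizes the upper bound divided by `t`.
  have h2 := hE (k * f.coeff 0 / ((k - 1) * f.coeff 1)) (by positivity)
  have h3 : 1 + k * f.coeff 0 / ((k - 1) * f.coeff 1) * (f.coeff 1 / f.coeff 0) / k
      = (k : ℝ) / (k - 1) := by
    field_simp
    ring
  rw [h3] at h2
  obtain ⟨m, rfl⟩ : ∃ m, k = m + 1 := ⟨k - 1, by omega⟩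
  have hm : (0 : ℝ) < m := by
    have : 1 ≤ m := by omega
    exact_mod_cast this
  simp only [g, Nat.add_sub_cancel]
  push_cast at h2 ⊢
  simp only [add_sub_cancel_right] at h2 ⊢
  have h4 : c * ((m + 1) * f.coeff 0 / (m * f.coeff 1))
      = (c / f.coeff 1) * (f.coeff 0 * ((m + 1) / m)) := by
    field_simp
  rw [h4, pow_succ, show f.coeff 0 * ((((m : ℝ) + 1) / m) ^ m * ((m + 1) / m))
    = (((m : ℝ) + 1) / m) ^ m * (f.coeff 0 * ((m + 1) / m)) by ring] at h2
  have h5 := le_of_mul_le_mul_right h2 (by positivity)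
  rw [div_le_iff₀ h1] at h5
  calc ((m : ℝ) / (m + 1)) ^ m * c
      ≤ ((m : ℝ) / (m + 1)) ^ m * ((((m : ℝ) + 1) / m) ^ m * f.coeff 1) := by gcongr
    _ = f.coeff 1 := by
      rw [← mul_assoc, ← mul_pow, div_mul_div_cancel₀ (by positivity), div_self hm.ne']
      simp

end Univariate

/-! ### Homogeneous polynomials stable in the right half-plane. -/

section StablePolynomial

open MvPolynomial

variable {n d : ℕ}

/-- `p` has no zeros with all coordinates in the open right half-plane. -/
def Stable (p : MvPolynomial (Fin n) ℝ) : Prop :=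
  ∀ z : Fin n → ℂ, (∀ i, 0 < (z i).re) → aeval z p ≠ 0

theorem aeval_mul_left {K : Type*} [CommRing K] [Algebra ℝ K] {p : MvPolynomial (Fin n) ℝ}
    (hp : p.IsHomogeneous d) (c : K) (z : Fin n → K) :
    aeval (fun i => c * z i) p = c ^ d * aeval z p := by
  rw [aeval_def, aeval_def, eval₂_eq', eval₂_eq', Finset.mul_sum]
  refine Finset.sum_congr rfl fun m hm => ?_
  have h : ∑ i, m i = d := by
    rw [hp.degree_eq_sum_deg_support hm]
    exact (Finset.sum_subset (Finset.subset_univ _) fun i _ hi =>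
      Finsupp.notMem_support_iff.1 hi).symm
  simp only [mul_pow, Finset.prod_mul_distrib, Finset.prod_pow_eq_pow_sum, h]
  ring

theorem aeval_ofReal (p : MvPolynomial (Fin n) ℝ) (x : Fin n → ℝ) :
    aeval (fun i => (x i : ℂ)) p = ((aeval x p : ℝ) : ℂ) :=
  aeval_algebraMap_apply ℂ x p

theorem aeval_nonneg {p : MvPolynomial (Fin n) ℝ} (hp : ∀ m, 0 ≤ p.coeff m) {x : Fin n → ℝ}
    (hx : ∀ i, 0 ≤ x i) : 0 ≤ aeval x p := by
  rw [aeval_def, eval₂_eq']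
  exact Finset.sum_nonneg fun m _ =>
    mul_nonneg (hp m) (Finset.prod_nonneg fun i _ => pow_nonneg (hx i) _)

theorem aeval_pos {p : MvPolynomial (Fin n) ℝ} (hp : ∀ m, 0 ≤ p.coeff m) (h0 : p ≠ 0)
    {x : Fin n → ℝ} (hx : ∀ i, 0 < x i) : 0 < aeval x p := by
  rw [aeval_def, eval₂_eq']
  refine Finset.sum_pos (fun m hm => ?_) (support_nonempty.2 h0)
  exact mul_pos ((hp m).lt_of_ne' (mem_support_iff.1 hm))
    (Finset.prod_pos fun i _ => pow_pos (hx i) _)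

/-- The polynomial `s ↦ p(x + i s y)`. -/
noncomputable def imaginaryLine (p : MvPolynomial (Fin n) ℝ) (x y : Fin n → ℝ) :
    Polynomial ℂ :=
  aeval (fun i => Polynomial.C (x i : ℂ) + Polynomial.C (Complex.I * y i) * Polynomial.X) p

theorem eval_imaginaryLine (p : MvPolynomial (Fin n) ℝ) (x y : Fin n → ℝ) (s : ℂ) :
    (imaginaryLine p x y).eval s = aeval (fun i => x i + Complex.I * y i * s) p := by
  have := comp_aeval_apply
    (fun i => Polynomial.C (x i : ℂ) + Polynomial.C (Complex.I * y i) * Polynomial.X)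
    ((Polynomial.aeval s : Polynomial ℂ →ₐ[ℂ] ℂ).restrictScalars ℝ) p
  simpa [imaginaryLine, Polynomial.coe_aeval_eq_eval] using this

/-- A homogeneous stable polynomial does not vanish at `x + i s y` unless `s` is imaginary. -/
theorem Stable.aeval_line_ne_zero {p : MvPolynomial (Fin n) ℝ} (hs : Stable p)
    (hp : p.IsHomogeneous d) {x y : Fin n → ℝ} (hx : ∀ i, 0 < x i) {s : ℂ} (h : s.re ≠ 0) :
    aeval (fun i => (x i : ℂ) + Complex.I * y i * s) p ≠ 0 := by
  have hs0 : s ≠ 0 := by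
    rintro rfl
    exact h rfl
  have hn : 0 < Complex.normSq s := Complex.normSq_pos.2 hs0
  -- Dividing the point by `s` leaves real parts `x i * s.re / |s|²`; the sign `e` makes them
  -- positive.
  have key : ∀ e : ℝ, 0 < e * s.re →
      aeval (fun i => (x i : ℂ) + Complex.I * y i * s) p ≠ 0 := by
    intro e he h0
    refine hs (fun i => (e * s⁻¹) * ((x i : ℂ) + Complex.I * y i * s)) (fun i => ?_) ?_
    · have : (e * s⁻¹) * ((x i : ℂ) + Complex.I * y i * s)
          = (e * x i : ℝ) * s⁻¹ + (e * y i : ℝ) * Complex.I := by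
        push_cast
        field_simp
      rw [this]
      simp only [Complex.add_re, Complex.re_ofReal_mul, Complex.inv_re, Complex.I_re, mul_zero,
        add_zero]
      rw [show e * x i * (s.re / Complex.normSq s) = (e * s.re) * x i / Complex.normSq s by ring]
      exact div_pos (mul_pos he (hx i)) hn
    · rw [aeval_mul_left hp, h0, mul_zero]
  rcases h.lt_or_gt with h | h
  · exact key (-1) (by linarith)
  · exact key 1 (by linarith)

theorem one_le_norm_multiset_prod (s : Multiset ℂ) (hs : ∀ x ∈ s, 1 ≤ ‖x‖) : 1 ≤ ‖s.prod‖ := by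
  induction s using Multiset.induction with
  | empty => simp
  | cons a s ih =>
    rw [Multiset.prod_cons, norm_mul]
    exact one_le_mul_of_one_le_of_one_le (hs a (Multiset.mem_cons_self a s))
      (ih fun x hx => hs x (Multiset.mem_cons_of_mem hx))

/-- On the line from `Re z` (`s = 0`) to `z` (`s = 1`) all roots `r` are imaginary, so each factor
`1 - 1 / r` has norm at least 1. -/
theorem Stable.aeval_re_le_norm {p : MvPolynomial (Fin n) ℝ} (hs : Stable p)
    (hp : p.IsHomogeneous d) {z : Fin n → ℂ} (hz : ∀ i, 0 < (z i).re) :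
    aeval (fun i => (z i).re) p ≤ ‖aeval z p‖ := by
  set f := imaginaryLine p (fun i => (z i).re) (fun i => (z i).im) with hf
  have h0 : f.coeff 0 = ((aeval (fun i => (z i).re) p : ℝ) : ℂ) := by
    rw [Polynomial.coeff_zero_eq_eval_zero, eval_imaginaryLine, ← aeval_ofReal]
    simp
  have h0' : f.coeff 0 ≠ 0 := by
    rw [h0, ← aeval_ofReal]
    exact hs _ (by simpa using hz)
  have h1 : f.eval 1 = aeval z p := by
    rw [eval_imaginaryLine]
    congr 2
    funext i
    rw [mul_one, mul_comm, Complex.re_add_im]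
  rw [← h1, eval_eq_coeff_zero_mul_prod (IsAlgClosed.splits f) h0', norm_mul, h0,
    Complex.norm_real]
  refine (le_abs_self _).trans (le_mul_of_one_le_right (abs_nonneg _) ?_)
  refine one_le_norm_multiset_prod _ fun w hw => ?_
  obtain ⟨r, hr, rfl⟩ := Multiset.mem_map.1 hw
  have hre : r.re = 0 := by
    by_contra h
    refine hs.aeval_line_ne_zero hp hz (y := fun i => (z i).im) h ?_
    rw [← eval_imaginaryLine]
    exact (Polynomial.mem_roots'.1 hr).2
  refine le_trans (le_of_eq ?_) (Complex.abs_re_le_norm _)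
  simp [hre]

/-- The univariate polynomial `t ↦ p(t, z)`. -/
noncomputable def fiber {K : Type*} [CommRing K] [Algebra ℝ K]
    (p : MvPolynomial (Fin (n + 1)) ℝ) (z : Fin n → K) : Polynomial K :=
  (finSuccEquiv ℝ n p).map (aeval z : MvPolynomial (Fin n) ℝ →ₐ[ℝ] K).toRingHom

section fiber

variable {K : Type*} [CommRing K] [Algebra ℝ K] (p : MvPolynomial (Fin (n + 1)) ℝ)

theorem coeff_fiber (z : Fin n → K) (i : ℕ) :
    (fiber p z).coeff i = aeval z ((finSuccEquiv ℝ n p).coeff i) := by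
  rw [fiber, Polynomial.coeff_map]
  rfl

theorem natDegree_fiber_le (z : Fin n → K) : (fiber p z).natDegree ≤ degreeOf 0 p := by
  rw [← natDegree_finSuccEquiv]
  exact Polynomial.natDegree_map_le

theorem eval_fiber (z : Fin n → K) (t : K) :
    (fiber p z).eval t = aeval (Fin.cons t z : Fin (n + 1) → K) p := by
  induction p using MvPolynomial.induction_on with
  | C a => simp [fiber, finSuccEquiv_apply]
  | add p q hp hq =>
    simp only [fiber, map_add, Polynomial.map_add, Polynomial.eval_add] at hp hq ⊢
    rw [hp, hq]
  | mul_X p i hp =>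
    simp only [fiber, map_mul, Polynomial.map_mul, Polynomial.eval_mul] at hp ⊢
    rw [hp, aeval_X]
    congr 1
    refine Fin.cases ?_ (fun j => ?_) i
    · rw [finSuccEquiv_X_zero]; simp
    · rw [finSuccEquiv_X_succ]; simp

end fiber

theorem map_fiber (p : MvPolynomial (Fin (n + 1)) ℝ) (x : Fin n → ℝ) :
    (fiber p x).map (algebraMap ℝ ℂ) = fiber p (fun i => (x i : ℂ)) := by
  ext i
  rw [Polynomial.coeff_map, coeff_fiber, coeff_fiber, aeval_ofReal]
  rfl

theorem coeff_finSuccEquiv_nonneg {p : MvPolynomial (Fin (n + 1)) ℝ} (hc : ∀ m, 0 ≤ p.coeff m)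
    (i : ℕ) (m : Fin n →₀ ℕ) : 0 ≤ ((finSuccEquiv ℝ n p).coeff i).coeff m := by
  rw [finSuccEquiv_coeff_coeff]
  exact hc _

theorem coeff_fiber_nonneg {p : MvPolynomial (Fin (n + 1)) ℝ} (hc : ∀ m, 0 ≤ p.coeff m)
    {x : Fin n → ℝ} (hx : ∀ i, 0 ≤ x i) (i : ℕ) : 0 ≤ (fiber p x).coeff i := by
  rw [coeff_fiber]
  exact aeval_nonneg (coeff_finSuccEquiv_nonneg hc i) hx

theorem Stable.splits_fiber {p : MvPolynomial (Fin (n + 1)) ℝ} (hs : Stable p)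
    (hp : p.IsHomogeneous d) {x : Fin n → ℝ} (hx : ∀ i, 0 < x i) : (fiber p x).Splits := by
  refine splits_of_forall_im_ne_zero fun t ht h0 => ?_
  rw [map_fiber, eval_fiber] at h0
  -- Rotate `(t, x)` into the open right half-plane.
  set w : ℂ := (|t.re| + 1 : ℝ) - ((|t.re| + 1) ^ 2 / t.im : ℝ) * Complex.I with hw
  refine hs (fun i => w * (Fin.cons t (fun i => (x i : ℂ)) : Fin (n + 1) → ℂ) i) (fun i => ?_) ?_
  · have ha : -|t.re| ≤ t.re := neg_abs_le _
    have h1 : 0 ≤ |t.re| := abs_nonneg _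
    refine Fin.cases ?_ (fun j => ?_) i
    · have : (w * t).re = (|t.re| + 1) * t.re + (|t.re| + 1) ^ 2 := by
        rw [hw]
        simp only [Complex.mul_re, Complex.sub_re, Complex.sub_im, Complex.ofReal_re,
          Complex.ofReal_im, Complex.mul_im, Complex.I_re, Complex.I_im]
        field_simp
        ring
      simp only [Fin.cons_zero]
      rw [this]
      nlinarith
    · simp only [Fin.cons_succ]
      rw [mul_comm, Complex.re_ofReal_mul, hw]
      simp only [Complex.mul_re, Complex.sub_re, Complex.ofReal_re, Complex.ofReal_im,
        Complex.I_re, Complex.I_im, mul_zero, zero_mul, sub_zero]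
      have := hx j
      positivity
  · rw [aeval_mul_left hp, h0, mul_zero]

/-- The coefficient of `x₀` in a stable homogeneous polynomial is zero or stable. -/
theorem Stable.coeff_one {p : MvPolynomial (Fin (n + 1)) ℝ} (hs : Stable p)
    (hp : p.IsHomogeneous d) (hc : ∀ m, 0 ≤ p.coeff m)
    (hq : (finSuccEquiv ℝ n p).coeff 1 ≠ 0) : Stable ((finSuccEquiv ℝ n p).coeff 1) := by
  intro z hz hz0
  set x : Fin n → ℝ := fun i => (z i).re with hx
  set f := fiber p z with hf
  set F := fiber p x with hF
  have hF0 : ∀ i, 0 ≤ F.coeff i := coeff_fiber_nonneg hc fun i => (hz i).le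
  have hF1 : 0 < F.coeff 1 := by
    rw [coeff_fiber]
    exact aeval_pos (coeff_finSuccEquiv_nonneg hc 1) hq hz
  have hf1 : f.coeff 1 = 0 := by rw [coeff_fiber, hz0]
  have hle : ∀ t : ℂ, 0 < t.re → F.coeff 0 + F.coeff 1 * t.re ≤ ‖f.eval t‖ := by
    intro t ht
    refine (coeff_zero_add_le_eval hF0 ht.le).trans ?_
    rw [eval_fiber, eval_fiber]
    have hcons : (Fin.cons t.re x : Fin (n + 1) → ℝ)
        = fun i => ((Fin.cons t z : Fin (n + 1) → ℂ) i).re := by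
      funext i
      refine Fin.cases ?_ (fun j => ?_) i <;> simp [hx]
    rw [hcons]
    refine hs.aeval_re_le_norm hp fun i => ?_
    refine Fin.cases ?_ (fun j => ?_) i <;> simp [ht, hz]
  -- If `F(0) = 0`, then `X ^ 2` divides `f`, against the linear lower bound `hle` near 0. Otherwise
  -- all roots of `f` have negative real part; `f'(0) = 0` makes the sum of `-r⁻¹` vanish, so there
  -- are no roots and `f` is constant, against `hle` for large `t`.
  rcases (hF0 0).eq_or_lt with h0 | h0
  · have hp0 : (finSuccEquiv ℝ n p).coeff 0 = 0 := by
      by_contra h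
      have := aeval_pos (coeff_finSuccEquiv_nonneg hc 0) h hz
      rw [← coeff_fiber] at this
      exact absurd h0 this.ne
    have hf0 : f.coeff 0 = 0 := by rw [coeff_fiber, hp0, map_zero]
    obtain ⟨u, hu⟩ : Polynomial.X ^ 2 ∣ f := by
      rw [Polynomial.X_pow_dvd_iff]
      intro i hi
      interval_cases i <;> assumption
    have hcont : Filter.Tendsto (fun t : ℝ => t * ‖u.eval (t : ℂ)‖) (nhdsWithin 0 (Set.Ioi 0))
        (nhds (0 * ‖u.eval ((0 : ℝ) : ℂ)‖)) :=
      (continuous_id.mul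
        (u.continuous.comp Complex.continuous_ofReal).norm).continuousWithinAt
    have := ge_of_tendsto (b := F.coeff 1) hcont (by
      filter_upwards [self_mem_nhdsWithin] with t ht
      have ht' : 0 < t := ht
      have h := hle t (by simpa using ht')
      rw [hu, ← h0] at h
      simp only [Complex.ofReal_re, zero_add, Polynomial.eval_mul, Polynomial.eval_pow,
        Polynomial.eval_X, norm_mul, norm_pow, Complex.norm_real, Real.norm_eq_abs,
        abs_of_pos ht'] at h
      have h' : t * F.coeff 1 ≤ t * (t * ‖u.eval (t : ℂ)‖) := by linarith
      exact le_of_mul_le_mul_left h' ht')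
    rw [zero_mul] at this
    exact absurd hF1 this.not_gt
  · have hle' : ∀ t : ℂ, 0 ≤ t.re → F.coeff 0 ≤ ‖f.eval t‖ := by
      intro t ht
      have hcont : Filter.Tendsto (fun e : ℝ => ‖f.eval (t + e)‖) (nhdsWithin 0 (Set.Ioi 0))
          (nhds ‖f.eval (t + (0 : ℝ))‖) :=
        (f.continuous.comp
          (continuous_const.add Complex.continuous_ofReal)).norm.continuousWithinAt
      rw [Complex.ofReal_zero, add_zero] at hcont
      refine ge_of_tendsto hcont ?_
      filter_upwards [self_mem_nhdsWithin] with e he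
      have he' : 0 < e := he
      have hpos : 0 < (t + e).re := by simpa using add_pos_of_nonneg_of_pos ht he'
      exact (le_add_of_nonneg_right (mul_nonneg hF1.le hpos.le)).trans (hle _ hpos)
    have hf0 : f.coeff 0 ≠ 0 := by
      rw [Polynomial.coeff_zero_eq_eval_zero, ← norm_pos_iff]
      exact h0.trans_le (hle' 0 (by simp))
    have hroot : ∀ r ∈ f.roots, r.re < 0 := by
      intro r hr
      by_contra h
      have h1 := hle' r (not_lt.1 h)
      rw [(Polynomial.mem_roots'.1 hr).2, norm_zero] at h1
      exact absurd h0 h1.not_gt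
    have hsum := coeff_one_eq_coeff_zero_mul_sum (IsAlgClosed.splits f) hf0
    rw [hf1, eq_comm, mul_eq_zero, or_iff_right hf0] at hsum
    have hempty : f.roots = 0 := by
      by_contra hne
      have hpos : 0 < (f.roots.map fun r => (-r⁻¹).re).sum := by
        obtain ⟨r, hr⟩ := Multiset.exists_mem_of_ne_zero hne
        have hterm : ∀ r ∈ f.roots, 0 < (-r⁻¹).re := by
          intro r hr
          have hr' := hroot r hr
          have hn : 0 < Complex.normSq r := Complex.normSq_pos.2 (by
            rintro rfl
            exact lt_irrefl _ hr')
          rw [Complex.neg_re, Complex.inv_re, ← neg_div]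
          exact div_pos (by linarith) hn
        refine (hterm r hr).trans_le (Multiset.single_le_sum ?_ _
          (Multiset.mem_map_of_mem (fun r : ℂ => (-r⁻¹).re) hr))
        intro y hy
        obtain ⟨s, hs, rfl⟩ := Multiset.mem_map.1 hy
        exact (hterm s hs).le
      have : (f.roots.map fun r => (-r⁻¹).re).sum = ((f.roots.map fun r => -r⁻¹).sum).re := by
        have h := map_multiset_sum Complex.reAddGroupHom (f.roots.map fun r => -r⁻¹)
        rw [Multiset.map_map] at h
        exact h.symm
      rw [this, hsum] at hpos
      exact lt_irrefl _ hpos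
    have hconst : ∀ t : ℂ, f.eval t = f.coeff 0 := by
      intro t
      rw [eval_eq_coeff_zero_mul_prod (IsAlgClosed.splits f) hf0, hempty]
      simp
    have := le_of_forall_mul_le_add_mul (a := ‖f.coeff 0‖) (b := 0) (c := F.coeff 1)
      fun t ht => by
        have h := hle t (by simpa using ht)
        rw [hconst, Complex.ofReal_re] at h
        linarith
    exact absurd hF1 this.not_gt

end StablePolynomial

/-! ### Capacity and its loss under extraction of a coefficient. -/

section Capacity

open MvPolynomial

variable {n : ℕ}

theorem capacity_le {p : MvPolynomial (Fin n) ℝ} (hp : ∀ m, 0 ≤ p.coeff m) {x : Fin n → ℝ}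
    (hx : ∀ i, 0 < x i) (h1 : ∏ i, x i = 1) : capacity p ≤ aeval x p := by
  refine csInf_le ⟨0, ?_⟩ ⟨x, ⟨hx, h1⟩, rfl⟩
  rintro _ ⟨y, hy, rfl⟩
  exact aeval_nonneg hp fun i => (hy.1 i).le

theorem le_capacity {p : MvPolynomial (Fin n) ℝ} {c : ℝ}
    (h : ∀ x : Fin n → ℝ, (∀ i, 0 < x i) → ∏ i, x i = 1 → c ≤ aeval x p) : c ≤ capacity p := by
  refine le_csInf ⟨_, fun _ => 1, ⟨fun _ => one_pos, by simp⟩, rfl⟩ ?_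
  rintro _ ⟨y, hy, rfl⟩
  exact h y hy.1 hy.2

/-- Since the degree equals the number of variables, scaling `x` to product 1 divides the value by
exactly `∏ i, x i`. -/
theorem capacity_mul_prod_le {p : MvPolynomial (Fin (n + 1)) ℝ} (hp : p.IsHomogeneous (n + 1))
    (hc : ∀ m, 0 ≤ p.coeff m) {x : Fin (n + 1) → ℝ} (hx : ∀ i, 0 < x i) :
    capacity p * ∏ i, x i ≤ aeval x p := by
  have hP : 0 < ∏ i, x i := Finset.prod_pos fun i _ => hx i
  set s : ℝ := ((∏ i, x i)⁻¹) ^ (((n + 1 : ℕ) : ℝ)⁻¹) with hs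
  have hs0 : 0 < s := Real.rpow_pos_of_pos (inv_pos.2 hP) _
  have hsn : s ^ (n + 1) = (∏ i, x i)⁻¹ :=
    Real.rpow_inv_natCast_pow (inv_pos.2 hP).le (Nat.succ_ne_zero n)
  have h := capacity_le hc (x := fun i => s * x i) (fun i => mul_pos hs0 (hx i)) (by
    rw [Finset.prod_mul_distrib, Finset.prod_const, Finset.card_univ, Fintype.card_fin, hsn,
      inv_mul_cancel₀ hP.ne'])
  rw [aeval_mul_left hp, hsn] at h
  calc capacity p * ∏ i, x i ≤ (∏ i, x i)⁻¹ * aeval x p * ∏ i, x i := by gcongr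
    _ = aeval x p := by field_simp

/-- Passing to the coefficient of `x₀` decreases the capacity by a factor of at most `g k`. -/
theorem g_mul_capacity_le {p : MvPolynomial (Fin (n + 1)) ℝ} (hs : Stable p)
    (hp : p.IsHomogeneous (n + 1)) (hc : ∀ m, 0 ≤ p.coeff m) {k : ℕ} (hk : degreeOf 0 p ≤ k) :
    g k * capacity p ≤ capacity ((finSuccEquiv ℝ n p).coeff 1) := by
  refine le_capacity fun x hx h1 => ?_
  rw [← coeff_fiber]
  refine g_mul_le_coeff_one (coeff_fiber_nonneg hc fun i => (hx i).le) (hs.splits_fiber hp hx)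
    ((natDegree_fiber_le p x).trans hk) fun t ht => ?_
  rw [eval_fiber]
  have := capacity_mul_prod_le hp hc (x := Fin.cons t x) fun i => by
    refine Fin.cases ?_ (fun j => ?_) i <;> simp [ht, hx]
  rwa [Fin.prod_cons, h1, mul_one] at this

/-- The exponent of `x₁ ⋯ xₙ`. -/
noncomputable def ones (n : ℕ) : Fin n →₀ ℕ := Finsupp.equivFunOnFinite.symm fun _ => 1

theorem ones_apply (j : Fin n) : ones n j = 1 := rfl

theorem cons_ones (n : ℕ) : (ones n).cons 1 = ones (n + 1) := by
  ext i
  refine Fin.cases ?_ (fun j => ?_) i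
  · rw [Finsupp.cons_zero, ones_apply]
  · rw [Finsupp.cons_succ, ones_apply, ones_apply]

/-- Gurvits' capacity inequality. -/
theorem prod_g_mul_capacity_le_coeff (p : MvPolynomial (Fin n) ℝ) (c : Fin n → ℕ)
    (hp : p.IsHomogeneous n) (hc : ∀ m, 0 ≤ p.coeff m) (hs : p = 0 ∨ Stable p)
    (hd : ∀ j, degreeOf j p ≤ c j) :
    (∏ j : Fin n, g (min (c j) (n - j))) * capacity p ≤ p.coeff (ones n) := by
  induction n with
  | zero =>
    have h := capacity_le hc (x := fun _ => 1) (fun _ => one_pos) (by simp)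
    rw [eq_C_of_isEmpty p, aeval_C] at h
    rw [Finset.univ_eq_empty, Finset.prod_empty, one_mul, Subsingleton.elim (ones 0) 0]
    rwa [← eq_C_of_isEmpty p] at h
  | succ n ih =>
    rcases hs with rfl | hs
    · have h := capacity_le hc (x := fun _ => 1) (fun _ => one_pos) (by simp)
      rw [map_zero] at h
      rw [coeff_zero]
      exact mul_nonpos_of_nonneg_of_nonpos (Finset.prod_nonneg fun j _ => g_nonneg _) h
    -- The total degree `n + 1` also bounds the degree in `x₀`.
    have h1 := g_mul_capacity_le hs hp hc (k := min (c 0) (n + 1))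
      (le_min (hd 0) ((degreeOf_le_totalDegree p 0).trans hp.totalDegree_le))
    have h2 := ih ((finSuccEquiv ℝ n p).coeff 1) (fun j => c j.succ)
      (hp.finSuccEquiv_coeff_isHomogeneous 1 n (add_comm 1 n)) (coeff_finSuccEquiv_nonneg hc 1)
      (or_iff_not_imp_left.2 fun hq => hs.coeff_one hp hc hq)
      fun j => (degreeOf_coeff_finSuccEquiv p j 1).trans (hd j.succ)
    rw [finSuccEquiv_coeff_coeff, cons_ones] at h2
    refine le_trans ?_ h2
    rw [Fin.prod_univ_succ]
    simp only [Fin.val_zero, Fin.val_succ, Nat.sub_zero, Nat.add_sub_add_right]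
    rw [mul_comm (g _), mul_assoc]
    exact mul_le_mul_of_nonneg_left h1 (Finset.prod_nonneg fun j _ => g_nonneg _)

/-! ### The product polynomial of a matrix. -/

section mulPoly

variable (A : Matrix (Fin n) (Fin n) ℝ)

theorem mulPoly_eq_sum : mulPoly A =
    ∑ σ : Fin n → Fin n, monomial (∑ i, Finsupp.single (σ i) 1) (∏ i, A i (σ i)) := by
  rw [mulPoly, Fintype.prod_sum]
  refine Finset.sum_congr rfl fun σ _ => ?_
  rw [monomial_sum_index, Finset.prod_mul_distrib, map_prod]
  rfl

theorem aeval_mulPoly {K : Type*} [CommRing K] [Algebra ℝ K] (z : Fin n → K) :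
    aeval z (mulPoly A) = ∏ i, ∑ j, algebraMap ℝ K (A i j) * z j := by
  simp [mulPoly, map_prod, map_sum]

theorem isHomogeneous_mulPoly : (mulPoly A).IsHomogeneous n := by
  have := IsHomogeneous.prod Finset.univ (fun i => ∑ j, C (A i j) * X j) (fun _ : Fin n => 1)
    fun i _ => IsHomogeneous.sum _ _ _ fun j _ => isHomogeneous_C_mul_X (A i j) j
  simpa [mulPoly] using this

theorem degreeOf_mulPoly_le (j : Fin n) : degreeOf j (mulPoly A) ≤ colCount A j := by
  classical
  rw [colCount, Set.ncard_eq_toFinset_card', Set.toFinset_ofPred, Finset.card_filter]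
  refine (degreeOf_prod_le _ _ _).trans (Finset.sum_le_sum fun i _ => ?_)
  refine (degreeOf_sum_le _ _ _).trans (Finset.sup_le fun k _ => ?_)
  by_cases hk : A i k = 0
  · simp [hk]
  · refine (degreeOf_C_mul_le _ _ _).trans ?_
    rw [degreeOf_X]
    split_ifs <;> simp_all

theorem coeff_ones_mulPoly : (mulPoly A).coeff (ones n) = A.permanent := by
  classical
  rw [mulPoly_eq_sum, coeff_sum, ← Matrix.permanent_transpose, Matrix.permanent]
  symm
  refine Finset.sum_of_injOn (fun τ : Equiv.Perm (Fin n) => (τ : Fin n → Fin n))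
    (DFunLike.coe_injective.injOn) (fun _ _ => Finset.mem_coe.2 (Finset.mem_univ _))
    (fun σ _ hσ => ?_) fun τ _ => ?_
  -- A choice function that is not a permutation misses some `j`, so its monomial lacks `x_j`.
  · rw [coeff_monomial, if_neg]
    intro h
    have hsurj : Function.Surjective σ := by
      intro j
      by_contra hj
      push Not at hj
      have := DFunLike.congr_fun h j
      rw [Finsupp.finsetSum_apply, ones_apply,
        Finset.sum_eq_zero fun i _ => Finsupp.single_eq_of_ne (hj i).symm] at this
      exact zero_ne_one this
    exact hσ ⟨Equiv.ofBijective σ (Finite.injective_iff_bijective.1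
      (Finite.injective_iff_surjective.2 hsurj)), Finset.mem_coe.2 (Finset.mem_univ _), rfl⟩
  · rw [coeff_monomial, if_pos]
    · rfl
    · rw [Equiv.sum_comp τ fun j => Finsupp.single j 1]
      ext j
      rw [Finsupp.finsetSum_apply, ones_apply]
      simp [Finsupp.single_apply]

variable {A}

theorem coeff_mulPoly_nonneg (hA : ∀ i j, 0 ≤ A i j) (m : Fin n →₀ ℕ) :
    0 ≤ (mulPoly A).coeff m := by
  classical
  rw [mulPoly_eq_sum, coeff_sum]
  refine Finset.sum_nonneg fun σ _ => ?_
  rw [coeff_monomial]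
  split_ifs
  · exact Finset.prod_nonneg fun i _ => hA _ _
  · exact le_rfl

theorem mulPoly_eq_zero_or_stable (hA : ∀ i j, 0 ≤ A i j) : mulPoly A = 0 ∨ Stable (mulPoly A) := by
  by_cases h : ∃ i, ∀ j, A i j = 0
  · obtain ⟨i, hi⟩ := h
    exact Or.inl (Finset.prod_eq_zero (Finset.mem_univ i) (by simp [hi]))
  · push Not at h
    refine Or.inr fun z hz => ?_
    rw [aeval_mulPoly]
    refine Finset.prod_ne_zero_iff.2 fun i _ h0 => ?_
    have hre : 0 < (∑ j, algebraMap ℝ ℂ (A i j) * z j).re := by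
      rw [Complex.re_sum]
      obtain ⟨j, hj⟩ := h i
      refine Finset.sum_pos' (fun k _ => ?_) ⟨j, Finset.mem_univ j, ?_⟩
      · rw [Complex.coe_algebraMap, Complex.re_ofReal_mul]
        exact mul_nonneg (hA i k) (hz k).le
      · rw [Complex.coe_algebraMap, Complex.re_ofReal_mul]
        exact mul_pos ((hA i j).lt_of_ne' hj) (hz j)
    rw [h0] at hre
    exact lt_irrefl _ hre

/-- Allowing any upper bound `c` on the column counts covers the uniform bound `k` without
monotonicity of `g`. -/
theorem prod_g_mul_capacity_le_permanent (hA : ∀ i j, 0 ≤ A i j) (c : Fin n → ℕ)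
    (hc : ∀ j, colCount A j ≤ c j) :
    (∏ j : Fin n, g (min (c j) (n - j))) * capacity (mulPoly A) ≤ A.permanent := by
  rw [← coeff_ones_mulPoly]
  exact prod_g_mul_capacity_le_coeff _ c (isHomogeneous_mulPoly A) (coeff_mulPoly_nonneg hA)
    (mulPoly_eq_zero_or_stable hA) fun j => (degreeOf_mulPoly_le A j).trans (hc j)

/-- The all-ones vector gives the value 1. Unit column sums turn `∏ j, x j = 1` into a product over
rows of weighted geometric means, and unit row sums allow weighted AM-GM in each row. -/
theorem capacity_mulPoly_of_mem_doublyStochastic (hA : A ∈ doublyStochastic ℝ (Fin n)) :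
    capacity (mulPoly A) = 1 := by
  have hnn : ∀ i j, 0 ≤ A i j := fun i j => nonneg_of_mem_doublyStochastic hA
  refine le_antisymm ?_ (le_capacity fun x hx h1 => ?_)
  · refine (capacity_le (coeff_mulPoly_nonneg hnn) (x := fun _ => 1) (fun _ => one_pos)
      (by simp)).trans (le_of_eq ?_)
    rw [aeval_mulPoly]
    simp [sum_row_of_mem_doublyStochastic hA]
  · rw [aeval_mulPoly]
    calc (1 : ℝ) = ∏ j, x j ^ ∑ i, A i j := by
          simp [sum_col_of_mem_doublyStochastic hA, h1]
      _ = ∏ j, ∏ i, x j ^ A i j :=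
          Finset.prod_congr rfl fun j _ => Real.rpow_sum_of_pos (hx j) _ _
      _ = ∏ i, ∏ j, x j ^ A i j := Finset.prod_comm
      _ ≤ ∏ i, ∑ j, A i j * x j :=
          Finset.prod_le_prod
            (fun i _ => Finset.prod_nonneg fun j _ => Real.rpow_nonneg (hx j).le _)
            fun i _ => Real.geom_mean_le_arith_mean_weighted _ _ _ (fun j _ => hnn i j)
              (sum_row_of_mem_doublyStochastic hA i) fun j _ => (hx j).le

end mulPoly

/-! ### Closed forms for the products of `g`. -/

theorem prod_range_g (k : ℕ) :
    ∏ j ∈ Finset.range k, g (k - j) = (k.factorial : ℝ) / (k : ℝ) ^ k := by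
  induction k with
  | zero => simp
  | succ k ih =>
    rw [Finset.prod_range_succ']
    simp only [Nat.add_sub_add_right, Nat.sub_zero]
    rw [ih, g, Nat.add_sub_cancel, Nat.factorial_succ]
    push_cast
    rw [add_sub_cancel_right, div_pow]
    rcases Nat.eq_zero_or_pos k with rfl | hk
    · simp
    · field_simp
      ring

/-- Each of the `n - k` columns beyond the last `k` contributes a factor `g k`. -/
theorem prod_range_g_min {k n : ℕ} (hkn : k ≤ n) :
    ∏ j ∈ Finset.range n, g (min k (n - j))
      = (((k : ℝ) - 1) / k) ^ ((k - 1) * (n - k)) * ((k.factorial : ℝ) / (k : ℝ) ^ k) := by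
  induction n, hkn using Nat.le_induction with
  | base =>
    rw [Nat.sub_self, mul_zero, pow_zero, one_mul, ← prod_range_g]
    exact Finset.prod_congr rfl fun j _ => by rw [min_eq_right (Nat.sub_le k j)]
  | succ n hkn ih =>
    rw [Finset.prod_range_succ']
    simp only [Nat.add_sub_add_right, Nat.sub_zero]
    rw [ih, min_eq_left (by omega), Nat.succ_sub hkn, Nat.mul_succ, pow_add, g]
    ring

end Capacity

end PermBound

/-- The columns are indexed by `j : Fin n`, so the column with 1-based number `m` is `j = m - 1`,
and `n + 1 - m` reads `n + 1 - (j + 1)`. -/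
theorem theorem3p1 (n : ℕ) (A : Matrix (Fin n) (Fin n) ℝ) (hA : ∀ i j, 0 ≤ A i j) :
    (∏ j : Fin n, PermBound.g (min (PermBound.colCount A j) (n + 1 - ((j : ℕ) + 1)))) *
        PermBound.capacity (PermBound.mulPoly A) ≤ A.permanent ∧
    (∀ k : ℕ, 1 ≤ k → k ≤ n → (∀ j : Fin n, PermBound.colCount A j ≤ k) →
      (((k : ℝ) - 1) / k) ^ ((k - 1) * (n - k)) * ((k.factorial : ℝ) / (k : ℝ) ^ k) *
        PermBound.capacity (PermBound.mulPoly A) ≤ A.permanent) ∧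
    (A ∈ doublyStochastic ℝ (Fin n) → PermBound.capacity (PermBound.mulPoly A) = 1) := by
  simp only [Nat.add_sub_add_right]
  refine ⟨PermBound.prod_g_mul_capacity_le_permanent hA _ fun _ => le_rfl, fun k _ hkn hk => ?_,
    PermBound.capacity_mulPoly_of_mem_doublyStochastic⟩
  rw [← PermBound.prod_range_g_min hkn,
    Finset.prod_range fun j => PermBound.g (min k (n - j))]
  exact PermBound.prod_g_mul_capacity_le_permanent hA (fun _ => k) hk
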